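/- Let $\mathcal G$ be a connected undirected graph on the nodes $\{1,\dots,N\}$ with adjacency matrix $[a_{ij}]$, $a_{ij}=a_{ji}\in\{0,1\}$. For each $i$ let $f^i:\mathbb R^d\to\mathbb R$ be twice differentiable, with gradient $g^i=\nabla f^i$ and Hessian $H^i=\nabla^2 f^i$, and suppose there are constants $\underline m^i,\bar m^i>0$ with $\underline m^i I\le H^i(x)\le \bar m^i I$ for all $x\in\mathbb R^d$ (in particular $f^i$ is strongly convex). Then $f(x)=\sum_{i=1}^N f^i(x)$ has a unique global minimizer $x^\star\in\mathbb R^d$, and the following holds. Consider the distributed HISO dynamics \[ z^i=g^i(x^i)+v^i, \] \[ \dot v^i=-\sum_{j=1}^N a_{ij}\,\mathrm{sgn}(z^i-z^j)+\sum_{j=1}^N a_{ij}(x^i-x^j), \] \[ \dot x^i=-H^i(x^i)^{-1}\Big(z^i+\sum_{j=1}^N a_{ij}(x^i-x^j)\Big),\qquad i=1,\dots,N, \] where $\mathrm{sgn}$ acts componentwise. Solutions are understood in the sense of Filippov: $x$ and $v$ are locally absolutely continuous on $[0,\infty)$ and satisfy the equations for almost every $t\ge 0$, with the discontinuous map $S(z)=\big(\sum_{j}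 a_{ij}\,\mathrm{sgn}(z^i-z^j)\big)_{i=1}^N$ replaced by its Filippov set-valued map $\bigcap_{\delta>0}\bigcap_{|Q|=0}\overline{\mathrm{co}}\,S(B(z,\delta)\setminus Q)$, so that the equation for $v$ becomes a differential inclusion. Then for every such solution, with any initial values $x^i(0),v^i(0)\in\mathbb R^d$ satisfying $\sum_{i=1}^N v^i(0)=0$, every $x^i(t)$ converges to $x^\star$ and every $z^i(t)$ converges to $0$ as $t\to\infty$. -/

import Mathlib

open MeasureTheory Filter Topology
open scoped Gradient InnerProductSpace

/-- The space `ℝ^d` with its Euclidean norm. -/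
abbrev Vec (d : ℕ) : Type := EuclideanSpace ℝ (Fin d)

/-- The Hessian `∇² f (x)`, as a linear operator on `ℝ^d`: the derivative of the gradient. -/
noncomputable def hessian {d : ℕ} (f : Vec d → ℝ) (x : Vec d) : Vec d →L[ℝ] Vec d :=
  fderiv ℝ (∇ f) x

/-- `f` is twice differentiable and `m I ≤ ∇² f (x) ≤ M I` for all `x`, with `m, M > 0`.
The lower bound says that `f` is `m`-strongly convex. -/
structure HasBoundedHessian {d : ℕ} (f : Vec d → ℝ) (m M : ℝ) : Prop where
  lower_pos : 0 < m
  upper_pos : 0 < M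
  differentiable : Differentiable ℝ f
  differentiable_gradient : Differentiable ℝ (∇ f)
  lower : ∀ x u : Vec d, m * ‖u‖ ^ 2 ≤ ⟪u, hessian f x u⟫_ℝ
  upper : ∀ x u : Vec d, ⟪u, hessian f x u⟫_ℝ ≤ M * ‖u‖ ^ 2

/-- The componentwise sign of a vector (with `sgn 0 = 0`). -/
noncomputable def sgn {d : ℕ} (u : Vec d) : Vec d := WithLp.toLp 2 fun k => Real.sign (u k)

/-- The Filippov set-valued map of a vector field `F`:
`K[F](y) = ⋂_{δ > 0} ⋂_{μ(S) = 0} closure (conv (F (B(y, δ) \ S)))`. -/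
def filippovMap {E : Type*} [NormedAddCommGroup E] [NormedSpace ℝ E] [MeasureSpace E]
    (F : E → E) (y : E) : Set E :=
  ⋂ (δ : ℝ) (_ : 0 < δ) (S : Set E) (_ : volume S = 0),
    closedConvexHull ℝ (F '' (Metric.ball y δ \ S))

section Network

variable {N d : ℕ} (G : SimpleGraph (Fin N)) [DecidableRel G.Adj]

/-- The sign interaction `i ↦ ∑ⱼ aᵢⱼ sgn (zⁱ - zʲ)`, with `aᵢⱼ` the adjacency matrix. -/
noncomputable def signInteraction (z : Fin N → Vec d) : Fin N → Vec d :=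
  fun i => ∑ j, G.adjMatrix ℝ i j • sgn (z i - z j)

/-- The Laplacian interaction `i ↦ ∑ⱼ aᵢⱼ (xⁱ - xʲ)`. -/
noncomputable def laplacianInteraction (x : Fin N → Vec d) : Fin N → Vec d :=
  fun i => ∑ j, G.adjMatrix ℝ i j • (x i - x j)

/-- The output `zⁱ = ∇fⁱ(xⁱ) + vⁱ`. -/
noncomputable def hisoOutput (f : Fin N → Vec d → ℝ) (x v : Fin N → Vec d) : Fin N → Vec d :=
  fun i => ∇ (f i) (x i) + v i

/-- `(x, v)` is a solution on `[0, ∞)`, in the sense of Filippov, of the distributed HISO dynamics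
`zⁱ = ∇fⁱ(xⁱ) + vⁱ`,
`v̇ⁱ = -∑ⱼ aᵢⱼ sgn (zⁱ - zʲ) + ∑ⱼ aᵢⱼ (xⁱ - xʲ)`,
`ẋⁱ = -∇²fⁱ(xⁱ)⁻¹ (zⁱ + ∑ⱼ aᵢⱼ (xⁱ - xʲ))`:
`x` and `v` are locally absolutely continuous and the equations hold at almost every `t ≥ 0`, where
the discontinuous sign interaction is replaced by its Filippov set-valued map. (All other terms are
continuous when the Hessians are, and `v ↦ z` is a translation; so for continuous Hessians
this is the Filippov solution of the whole system in the state `(x, v)`.) -/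
structure IsHISOSolution (f : Fin N → Vec d → ℝ) (x v : ℝ → Fin N → Vec d) : Prop where
  absolutelyContinuous_x : ∀ T : ℝ, 0 ≤ T → AbsolutelyContinuousOnInterval x 0 T
  absolutelyContinuous_v : ∀ T : ℝ, 0 ≤ T → AbsolutelyContinuousOnInterval v 0 T
  deriv_x : ∀ᵐ t : ℝ, 0 ≤ t → ∀ i : Fin N,
    HasDerivAt (fun s => x s i)
      (-(hessian (f i) (x t i)).inverse
        (hisoOutput f (x t) (v t) i + laplacianInteraction G (x t) i)) t
  deriv_v : ∀ᵐ t : ℝ, 0 ≤ t → ∃ ξ ∈ filippovMap (signInteraction G) (hisoOutput f (x t) (v t)),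
    HasDerivAt v (-ξ + laplacianInteraction G (x t)) t

end Network

/-! Along a solution `ż = -(z + ξ)` almost everywhere, with `ξ` in the Filippov set at `z`: the
Hessian cancels its inverse, and the two Laplacian terms cancel. As `⟪z, ξ⟫ ≥ 0`, `‖z‖²` decays
exponentially. With `u` the Laplacian of `x`, the energy `⟪x, u⟫` has derivative at most `-‖u‖²/A +
β‖z‖²`, and `⟪x, u⟫ ≤ C‖u‖²`. Hence `⟪x, u⟫ + β‖z‖²` satisfies `ẇ ≤ -κw` and tends to `0`
(`exists_tendsto_lyapunov`). This gives `z → 0` and, by connectedness, consensus.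

The interactions are antisymmetric over edges, so `∑ vⁱ` stays `0` and `∑ ∇fⁱ(xⁱ) = ∑ zⁱ → 0`.
Strong monotonicity (`norm_sub_le_of_sum_gradient_eq_zero`) turns this, with consensus, into
convergence to the stationary point, which is the unique minimizer. -/

/-! ### Estimates for a single strongly convex function. -/

namespace HasBoundedHessian

variable {d : ℕ} {f : Vec d → ℝ} {m M : ℝ}

theorem hasFDerivAt_gradient (hf : HasBoundedHessian f m M) (x : Vec d) :
    HasFDerivAt (∇ f) (hessian f x) x :=
  (hf.differentiable_gradient x).hasFDerivAt

theorem hasFDerivAt (hf : HasBoundedHessian f m M) (x : Vec d) :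
    HasFDerivAt f (innerSL ℝ (∇ f x)) x :=
  (hf.differentiable x).hasGradientAt.hasFDerivAt

theorem hessian_symm (hf : HasBoundedHessian f m M) (x u w : Vec d) :
    ⟪hessian f x u, w⟫_ℝ = ⟪u, hessian f x w⟫_ℝ := by
  have h := second_derivative_symmetric (f := f) (f' := fun y => innerSL ℝ (∇ f y))
    (f'' := (innerSL ℝ (E := Vec d)).comp (hessian f x)) (x := x) hf.hasFDerivAt
    ((innerSL ℝ (E := Vec d)).hasFDerivAt.comp x (hf.hasFDerivAt_gradient x)) u w
  simpa [real_inner_comm] using h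

/-- The Hessian is cocoercive. -/
theorem norm_sq_hessian_le (hf : HasBoundedHessian f m M) (x u : Vec d) :
    ‖hessian f x u‖ ^ 2 ≤ M * ⟪u, hessian f x u⟫_ℝ := by
  have hM := hf.upper_pos
  -- With `H` the Hessian and `w = Mu - Hu`, expanding `⟪w, Hw⟫ ≥ 0` and using `⟪Hu, H(Hu)⟫ ≤
  -- M‖Hu‖²` leaves `M(M⟪u, Hu⟫ - ‖Hu‖²) ≥ 0`.
  have h1 := hf.lower x (M • u - hessian f x u)
  have h2 := hf.upper x (hessian f x u)
  have h3 : 0 ≤ m * ‖M • u - hessian f x u‖ ^ 2 := mul_nonneg hf.lower_pos.le (sq_nonneg _)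
  have h4 := hf.hessian_symm x u (hessian f x u)
  simp only [map_sub, map_smul, inner_sub_left, inner_sub_right, inner_smul_left,
    inner_smul_right, real_inner_self_eq_norm_sq, conj_trivial] at h1 h4
  have h5 : 0 ≤ M * (M * ⟪u, hessian f x u⟫_ℝ - ‖hessian f x u‖ ^ 2) := by nlinarith
  have := nonneg_of_mul_nonneg_right h5 hM
  linarith

theorem norm_hessian_apply_le (hf : HasBoundedHessian f m M) (x u : Vec d) :
    ‖hessian f x u‖ ≤ M * ‖u‖ := by
  have h1 := hf.norm_sq_hessian_le x u
  have h2 := hf.upper x u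
  have hM := hf.upper_pos
  refine abs_le_of_sq_le_sq' ?_ (by positivity) |>.2
  nlinarith

theorem isInvertible_hessian (hf : HasBoundedHessian f m M) (x : Vec d) :
    (hessian f x).IsInvertible := by
  have hinj : Function.Injective (hessian f x : Vec d →ₗ[ℝ] Vec d) := by
    rw [← LinearMap.ker_eq_bot, LinearMap.ker_eq_bot']
    intro u hu
    have h := hf.lower x u
    rw [show hessian f x u = 0 from hu, inner_zero_right] at h
    have := hf.lower_pos
    by_contra hne
    have : 0 < ‖u‖ := norm_pos_iff.mpr hne
    have : 0 < m * ‖u‖ ^ 2 := by positivity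
    linarith
  refine ⟨(LinearEquiv.ofInjectiveEndo _ hinj).toContinuousLinearEquiv, ?_⟩
  ext u
  rfl

theorem norm_inverse_hessian_le (hf : HasBoundedHessian f m M) (x w : Vec d) :
    m * ‖(hessian f x).inverse w‖ ≤ ‖w‖ := by
  set u := (hessian f x).inverse w with hu
  have hw : hessian f x u = w := (hf.isInvertible_hessian x).self_apply_inverse w
  have h := hf.lower x u
  rw [hw] at h
  have h2 := real_inner_le_norm u w
  rcases (norm_nonneg u).eq_or_lt with h0 | h0
  · rw [← h0]; simp
  · by_contra! hlt
    nlinarith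

theorem norm_sq_le_inner_inverse_hessian (hf : HasBoundedHessian f m M) (x w : Vec d) :
    ‖w‖ ^ 2 ≤ M * ⟪w, (hessian f x).inverse w⟫_ℝ := by
  have hw : hessian f x ((hessian f x).inverse w) = w :=
    (hf.isInvertible_hessian x).self_apply_inverse w
  have h := hf.norm_sq_hessian_le x ((hessian f x).inverse w)
  rwa [hw, real_inner_comm] at h

/-- The `w` part of `H⁻¹(z + w)` contributes at least `‖w‖²/M` by cocoercivity. Young's inequality
spends half of that on the cross term, where `‖H⁻¹z‖ ≤ ‖z‖/m`. -/
theorem inner_inverse_hessian_add_ge (hf : HasBoundedHessian f m M) (x w z : Vec d) :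
    ‖w‖ ^ 2 / (2 * M) - M / (2 * m ^ 2) * ‖z‖ ^ 2 ≤
      ⟪w, (hessian f x).inverse (z + w)⟫_ℝ := by
  have hm := hf.lower_pos
  have hM := hf.upper_pos
  have h1 := hf.norm_sq_le_inner_inverse_hessian x w
  have h2 := hf.norm_inverse_hessian_le x z
  have h3 := (abs_le.mp (abs_real_inner_le_norm w ((hessian f x).inverse z))).1
  rw [map_add, inner_add_right]
  have h4 : ‖w‖ ^ 2 / M ≤ ⟪w, (hessian f x).inverse w⟫_ℝ := by
    rw [div_le_iff₀ hM]; linarith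
  have h5 : ‖(hessian f x).inverse z‖ ≤ ‖z‖ / m := by
    rw [le_div_iff₀ hm]; linarith
  have h6 : ‖w‖ * ‖(hessian f x).inverse z‖ ≤ ‖w‖ * (‖z‖ / m) := by gcongr
  have h7 : ‖w‖ ^ 2 / M - ‖w‖ * (‖z‖ / m) - (‖w‖ ^ 2 / (2 * M) - M / (2 * m ^ 2) * ‖z‖ ^ 2)
      = (‖w‖ - M * (‖z‖ / m)) ^ 2 / (2 * M) := by
    field_simp
    ring
  have h8 : 0 ≤ (‖w‖ - M * (‖z‖ / m)) ^ 2 / (2 * M) := by positivity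
  linarith

theorem norm_gradient_sub_le (hf : HasBoundedHessian f m M) (x y : Vec d) :
    ‖∇ f y - ∇ f x‖ ≤ M * ‖y - x‖ :=
  convex_univ.norm_image_sub_le_of_norm_hasFDerivWithin_le
    (fun z _ => (hf.hasFDerivAt_gradient z).hasFDerivWithinAt)
    (fun z _ => ContinuousLinearMap.opNorm_le_bound _ hf.upper_pos.le
      (hf.norm_hessian_apply_le z)) (Set.mem_univ x) (Set.mem_univ y)

theorem lipschitzWith_gradient (hf : HasBoundedHessian f m M) :
    LipschitzWith M.toNNReal (∇ f) :=
  LipschitzWith.of_dist_le_mul fun x y => by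
    rw [dist_eq_norm, dist_eq_norm, Real.coe_toNNReal _ hf.upper_pos.le]
    exact hf.norm_gradient_sub_le y x

/-- The mean value theorem for the gradient along the segment suffices, so the Hessian need not be
continuous. -/
theorem inner_gradient_sub_ge (hf : HasBoundedHessian f m M) (x y : Vec d) :
    m * ‖y - x‖ ^ 2 ≤ ⟪∇ f y - ∇ f x, y - x⟫_ℝ := by
  have hline : ∀ t : ℝ, HasDerivAt (fun t : ℝ => x + t • (y - x)) (y - x) t := fun t => by
    simpa using ((hasDerivAt_id t).smul_const (y - x)).const_add x
  have hd : ∀ t : ℝ, HasDerivAt (fun t : ℝ => ⟪y - x, ∇ f (x + t • (y - x))⟫_ℝ)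
      ⟪y - x, hessian f (x + t • (y - x)) (y - x)⟫_ℝ t := fun t => by
    simpa using (hasDerivAt_const t (y - x)).inner ℝ
      ((hf.hasFDerivAt_gradient (x + t • (y - x))).comp_hasDerivAt t (hline t))
  obtain ⟨c, -, hc⟩ := exists_hasDerivAt_eq_slope _ _ zero_lt_one
    (fun t _ => (hd t).continuousAt.continuousWithinAt) (fun t _ => hd t)
  have h := hf.lower (x + c • (y - x)) (y - x)
  rw [hc] at h
  simp only [one_smul, zero_smul, add_zero, sub_zero, div_one, add_sub_cancel] at h
  rwa [← inner_sub_right, real_inner_comm] at h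

theorem add_inner_add_le (hf : HasBoundedHessian f m M) (x y : Vec d) :
    f x + ⟪∇ f x, y - x⟫_ℝ + m / 2 * ‖y - x‖ ^ 2 ≤ f y := by
  have hline : ∀ t : ℝ, HasDerivAt (fun t : ℝ => x + t • (y - x)) (y - x) t := fun t => by
    simpa using ((hasDerivAt_id t).smul_const (y - x)).const_add x
  have hd : ∀ t : ℝ, HasDerivAt
      (fun t : ℝ => f (x + t • (y - x)) - t * ⟪∇ f x, y - x⟫_ℝ - t ^ 2 * (m / 2 * ‖y - x‖ ^ 2))
      (⟪∇ f (x + t • (y - x)), y - x⟫_ℝ - ⟪∇ f x, y - x⟫_ℝ - t * (m * ‖y - x‖ ^ 2)) t := fun t => by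
    have h1 := (hf.hasFDerivAt (x + t • (y - x))).comp_hasDerivAt t (hline t)
    have h2 := (hasDerivAt_id t).mul_const ⟪∇ f x, y - x⟫_ℝ
    have h3 := (hasDerivAt_pow 2 t).mul_const (m / 2 * ‖y - x‖ ^ 2)
    refine ((h1.sub h2).sub h3).congr_deriv ?_
    rw [innerSL_apply_apply]
    push_cast
    ring
  obtain ⟨c, hc, hc'⟩ := exists_hasDerivAt_eq_slope _ _ zero_lt_one
    (fun t _ => (hd t).continuousAt.continuousWithinAt) (fun t _ => hd t)
  have h := hf.inner_gradient_sub_ge x (x + c • (y - x))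
  simp only [add_sub_cancel_left, norm_smul, inner_smul_right, inner_sub_left, mul_pow,
    Real.norm_eq_abs, sq_abs] at h
  have h' : 0 ≤ ⟪∇ f (x + c • (y - x)), y - x⟫_ℝ - ⟪∇ f x, y - x⟫_ℝ - c * (m * ‖y - x‖ ^ 2) := by
    -- Monotonicity between `x` and `x + c(y - x)` carries an extra factor `c > 0`, divided out
    -- here.
    refine nonneg_of_mul_nonneg_right (a := c) ?_ hc.1
    nlinarith
  rw [hc'] at h'
  simp only [one_smul, zero_smul, add_zero, sub_zero, div_one, add_sub_cancel] at h'
  linarith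

end HasBoundedHessian

/-! ### The global objective and its minimizer. -/

section Sum

variable {ι : Type*} [Fintype ι] {d : ℕ} {f : ι → Vec d → ℝ} {m M : ι → ℝ}

theorem sum_lower_bound_pos [Nonempty ι] (hf : ∀ i, HasBoundedHessian (f i) (m i) (M i)) : 0 < ∑ i, m i :=
  Finset.sum_pos (fun i _ => (hf i).lower_pos) Finset.univ_nonempty

theorem sum_add_inner_add_le (hf : ∀ i, HasBoundedHessian (f i) (m i) (M i)) (x y : Vec d) :
    ∑ i, f i x + ⟪∑ i, ∇ (f i) x, y - x⟫_ℝ + (∑ i, m i) / 2 * ‖y - x‖ ^ 2 ≤ ∑ i, f i y := by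
  rw [sum_inner, Finset.sum_div, Finset.sum_mul, ← Finset.sum_add_distrib,
    ← Finset.sum_add_distrib]
  exact Finset.sum_le_sum fun i _ => (hf i).add_inner_add_le x y

theorem exists_sum_gradient_eq_zero [Nonempty ι]
    (hf : ∀ i, HasBoundedHessian (f i) (m i) (M i)) :
    ∃ x, ∑ i, ∇ (f i) x = 0 := by
  have hm := sum_lower_bound_pos hf
  have hd : ∀ x, HasFDerivAt (fun y => ∑ i, f i y) (innerSL ℝ (∑ i, ∇ (f i) x)) x := fun x => by
    rw [map_sum]
    exact HasFDerivAt.fun_sum fun i _ => (hf i).hasFDerivAt x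
  have hcont : Continuous fun y => ∑ i, f i y :=
    continuous_iff_continuousAt.mpr fun x => (hd x).continuousAt
  have hlim : Tendsto (fun y => ∑ i, f i y) (cocompact (Vec d)) atTop := by
    -- The quadratic lower bound at `0` makes the sum coercive, so a minimum is attained.
    have hq : Tendsto (fun r : ℝ => ∑ i, f i 0 + r * ((∑ i, m i) / 2 * r - ‖∑ i, ∇ (f i) 0‖))
        atTop atTop :=
      tendsto_atTop_add_const_left _ _ (tendsto_id.atTop_mul_atTop₀
        (tendsto_atTop_add_const_right _ _ (tendsto_id.const_mul_atTop (half_pos hm))))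
    refine tendsto_atTop_mono (fun y => ?_) (hq.comp (tendsto_norm_cocompact_atTop (E := Vec d)))
    have h1 := sum_add_inner_add_le hf 0 y
    have h2 := (abs_le.mp (abs_real_inner_le_norm (∑ i, ∇ (f i) 0) (y - 0))).1
    simp only [sub_zero] at h1 h2
    simp only [Function.comp_apply]
    nlinarith
  obtain ⟨x, hx⟩ := hcont.exists_forall_le hlim
  refine ⟨x, ?_⟩
  have h0 := (IsLocalMin.hasFDerivAt_eq_zero (Eventually.of_forall hx) (hd x))
  have := DFunLike.congr_fun h0 (∑ i, ∇ (f i) x)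
  rw [innerSL_apply_apply] at this
  exact inner_self_eq_zero.mp this

theorem sum_lt_sum_of_sum_gradient_eq_zero [Nonempty ι]
    (hf : ∀ i, HasBoundedHessian (f i) (m i) (M i))
    {x y : Vec d} (hx : ∑ i, ∇ (f i) x = 0) (hy : y ≠ x) : ∑ i, f i x < ∑ i, f i y := by
  have h := sum_add_inner_add_le hf x y
  have hm := sum_lower_bound_pos hf
  have h1 : 0 < ‖y - x‖ := norm_pos_iff.mpr (sub_ne_zero.mpr hy)
  have h2 : 0 < (∑ i, m i) / 2 * ‖y - x‖ ^ 2 := by positivity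
  rw [hx, inner_zero_left] at h
  linarith

/-- Strong monotonicity bounds the distance to the stationary point by the sum of the gradients,
each evaluated at a point of its own. -/
theorem norm_sub_le_of_sum_gradient_eq_zero (hf : ∀ i, HasBoundedHessian (f i) (m i) (M i))
    {x : Vec d} (hx : ∑ i, ∇ (f i) x = 0) (y : Vec d) (p : ι → Vec d) :
    (∑ i, m i) * ‖y - x‖ ≤ ‖∑ i, ∇ (f i) (p i)‖ + ∑ i, M i * ‖p i - y‖ := by
  have h1 : (∑ i, m i) * ‖y - x‖ ^ 2 ≤ ⟪∑ i, ∇ (f i) y, y - x⟫_ℝ := by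
    have : ∑ i, ∇ (f i) y = ∑ i, (∇ (f i) y - ∇ (f i) x) := by
      rw [Finset.sum_sub_distrib, hx, sub_zero]
    rw [this, sum_inner, Finset.sum_mul]
    exact Finset.sum_le_sum fun i _ => (hf i).inner_gradient_sub_ge x y
  have h2 : (∑ i, m i) * ‖y - x‖ ≤ ‖∑ i, ∇ (f i) y‖ := by
    have h3 := real_inner_le_norm (∑ i, ∇ (f i) y) (y - x)
    rcases (norm_nonneg (y - x)).eq_or_lt with h0 | h0
    · rw [← h0]; simp
    · by_contra! hlt
      nlinarith
  refine h2.trans ?_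
  have h3 : ∑ i, ∇ (f i) y = ∑ i, ∇ (f i) (p i) - ∑ i, (∇ (f i) (p i) - ∇ (f i) y) := by
    rw [Finset.sum_sub_distrib]; abel
  rw [h3]
  refine (norm_sub_le _ _).trans (add_le_add le_rfl ((norm_sum_le _ _).trans ?_))
  exact Finset.sum_le_sum fun i _ => (hf i).norm_gradient_sub_le y (p i)

end Sum

/-- One radius and the null set `∅` already bound the intersection from above. -/
theorem filippovMap_subset {E : Type*} [NormedAddCommGroup E] [NormedSpace ℝ E] [MeasureSpace E]
    {F : E → E} {y : E} {C : Set E} (hconv : Convex ℝ C) (hclosed : IsClosed C) {δ : ℝ}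
    (hδ : 0 < δ) (h : ∀ p ∈ Metric.ball y δ, F p ∈ C) : filippovMap F y ⊆ C := by
  intro ξ hξ
  simp only [filippovMap, Set.mem_iInter] at hξ
  refine closedConvexHull_min ?_ hconv hclosed (hξ δ hδ ∅ measure_empty)
  rintro _ ⟨p, hp, rfl⟩
  exact h p hp.1

/-! ### Sign and Laplacian interactions on the graph. -/

section Graph

variable {d : ℕ}

theorem sgn_neg (u : Vec d) : sgn (-u) = -sgn u := by
  ext k
  simp [sgn, Real.sign_neg]

theorem norm_sgn_le (u : Vec d) : ‖sgn u‖ ≤ √d := by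
  rw [EuclideanSpace.norm_eq]
  refine Real.sqrt_le_sqrt ?_
  calc ∑ k, ‖sgn u k‖ ^ 2 ≤ ∑ _k : Fin d, (1 : ℝ) := Finset.sum_le_sum fun k _ => by
        rcases Real.sign_apply_eq (u k) with h | h | h <;> simp [sgn, h]
    _ = d := by simp

theorem inner_sgn_nonneg (u : Vec d) : 0 ≤ ⟪u, sgn u⟫_ℝ := by
  rw [PiLp.inner_apply]
  refine Finset.sum_nonneg fun k _ => ?_
  rcases lt_trichotomy (u k) 0 with h | h | h
  · simp [sgn, Real.sign_of_neg h, h.le]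
  · simp [sgn, h]
  · simp [sgn, Real.sign_of_pos h, h.le]

variable {N : ℕ} (G : SimpleGraph (Fin N)) [DecidableRel G.Adj]

theorem adjMatrix_apply_symm (i j : Fin N) : G.adjMatrix ℝ i j = G.adjMatrix ℝ j i :=
  (G.isSymm_adjMatrix.apply i j).symm

/-- Exchanging the indices sends the sum to its negative. -/
theorem sum_adjMatrix_smul_eq_zero {w : Fin N → Fin N → Vec d} (hw : ∀ i j, w i j = -w j i) :
    ∑ i, ∑ j, G.adjMatrix ℝ i j • w i j = 0 := by
  have h : ∑ i, ∑ j, G.adjMatrix ℝ i j • w i j = -∑ i, ∑ j, G.adjMatrix ℝ i j • w i j := by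
    conv_lhs => rw [Finset.sum_comm]
    simp only [← Finset.sum_neg_distrib]
    refine Finset.sum_congr rfl fun i _ => Finset.sum_congr rfl fun j _ => ?_
    rw [hw j i, adjMatrix_apply_symm, smul_neg]
  have h2 : (2 : ℝ) • ∑ i, ∑ j, G.adjMatrix ℝ i j • w i j = 0 := by
    rw [two_smul]
    exact eq_neg_iff_add_eq_zero.mp h
  exact (smul_eq_zero.mp h2).resolve_left two_ne_zero

/-- Summation by parts on a graph. -/
theorem sum_inner_sum_adjMatrix_smul (u : Fin N → Vec d) {w : Fin N → Fin N → Vec d}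
    (hw : ∀ i j, w i j = -w j i) :
    ∑ i, ⟪u i, ∑ j, G.adjMatrix ℝ i j • w i j⟫_ℝ =
      (∑ i, ∑ j, G.adjMatrix ℝ i j * ⟪u i - u j, w i j⟫_ℝ) / 2 := by
  have h1 : ∑ i, ⟪u i, ∑ j, G.adjMatrix ℝ i j • w i j⟫_ℝ =
      ∑ i, ∑ j, G.adjMatrix ℝ i j * ⟪u i, w i j⟫_ℝ := by
    simp only [inner_sum, inner_smul_right]
  have h2 : ∑ i, ∑ j, G.adjMatrix ℝ i j * ⟪u j, w i j⟫_ℝ =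
      -∑ i, ∑ j, G.adjMatrix ℝ i j * ⟪u i, w i j⟫_ℝ := by
    rw [Finset.sum_comm]
    simp only [← Finset.sum_neg_distrib]
    refine Finset.sum_congr rfl fun i _ => Finset.sum_congr rfl fun j _ => ?_
    rw [hw j i, adjMatrix_apply_symm, inner_neg_right, mul_neg]
  rw [h1]
  simp only [inner_sub_left, mul_sub, Finset.sum_sub_distrib, h2]
  ring

theorem adjMatrix_nonneg (i j : Fin N) : 0 ≤ G.adjMatrix ℝ i j := by
  rw [SimpleGraph.adjMatrix_apply]
  split <;> norm_num

theorem sum_signInteraction (z : Fin N → Vec d) : ∑ i, signInteraction G z i = 0 :=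
  sum_adjMatrix_smul_eq_zero G fun i j => by rw [← sgn_neg, neg_sub]

theorem sum_laplacianInteraction (x : Fin N → Vec d) : ∑ i, laplacianInteraction G x i = 0 :=
  sum_adjMatrix_smul_eq_zero G fun i j => by rw [neg_sub]

theorem sum_inner_signInteraction_nonneg (z : Fin N → Vec d) :
    0 ≤ ∑ i, ⟪z i, signInteraction G z i⟫_ℝ := by
  have h := sum_inner_sum_adjMatrix_smul G z (w := fun i j => sgn (z i - z j))
    fun i j => by rw [← sgn_neg, neg_sub]
  unfold signInteraction
  rw [h]
  exact div_nonneg (Finset.sum_nonneg fun i _ => Finset.sum_nonneg fun j _ =>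
    mul_nonneg (adjMatrix_nonneg G i j) (inner_sgn_nonneg _)) zero_le_two

theorem sum_inner_laplacianInteraction (x y : Fin N → Vec d) :
    ∑ i, ⟪x i, laplacianInteraction G y i⟫_ℝ =
      (∑ i, ∑ j, G.adjMatrix ℝ i j * ⟪x i - x j, y i - y j⟫_ℝ) / 2 :=
  sum_inner_sum_adjMatrix_smul G x fun i j => by rw [neg_sub]

theorem sum_inner_laplacianInteraction_comm (x y : Fin N → Vec d) :
    ∑ i, ⟪x i, laplacianInteraction G y i⟫_ℝ = ∑ i, ⟪laplacianInteraction G x i, y i⟫_ℝ := by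
  simp_rw [real_inner_comm (y _) (laplacianInteraction G x _), sum_inner_laplacianInteraction,
    real_inner_comm (x _ - x _)]

theorem norm_signInteraction_le (z : Fin N → Vec d) (i : Fin N) :
    ‖signInteraction G z i‖ ≤ N * √d := by
  refine (norm_sum_le _ _).trans ?_
  calc ∑ j, ‖G.adjMatrix ℝ i j • sgn (z i - z j)‖ ≤ ∑ _j : Fin N, √d :=
        Finset.sum_le_sum fun j _ => by
          rw [SimpleGraph.adjMatrix_apply]
          split
          · simpa using norm_sgn_le _
          · simp
    _ = N * √d := by simp

theorem sum_eq_zero_of_mem_filippovMap {z ξ : Fin N → Vec d}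
    (hξ : ξ ∈ filippovMap (signInteraction G) z) : ∑ i, ξ i = 0 := by
  let φ : (Fin N → Vec d) →L[ℝ] Vec d := ∑ i, ContinuousLinearMap.proj i
  have hφ : ∀ η, φ η = ∑ i, η i := fun η => by simp [φ]
  have hC : filippovMap (signInteraction G) z ⊆ φ ⁻¹' {0} :=
    filippovMap_subset ((convex_singleton 0).linear_preimage (φ : (Fin N → Vec d) →ₗ[ℝ] Vec d))
      (isClosed_singleton.preimage φ.continuous) one_pos fun p _ => by
        rw [Set.mem_preimage, hφ, sum_signInteraction]; rfl
  have := hC hξ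
  rwa [Set.mem_preimage, hφ] at this

/-- At a point `p` near `z`, the interaction pairs nonnegatively with `p`; since it is bounded,
pairing with `z` instead loses at most `ε`. The resulting half-space is closed and convex, hence
contains the Filippov set. -/
theorem sum_inner_nonneg_of_mem_filippovMap {z ξ : Fin N → Vec d}
    (hξ : ξ ∈ filippovMap (signInteraction G) z) : 0 ≤ ∑ i, ⟪z i, ξ i⟫_ℝ := by
  let φ : (Fin N → Vec d) →L[ℝ] ℝ := ∑ i, (innerSL ℝ (z i)).comp (ContinuousLinearMap.proj i)
  have hφ : ∀ η, φ η = ∑ i, ⟪z i, η i⟫_ℝ := fun η => by simp [φ]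
  rw [← hφ]
  refine le_of_forall_pos_sub_le fun ε hε => ?_
  -- On a ball of radius `ε / K` the total error is at most `ε`; the `+ 1` covers `N = 0` or `d =
  -- 0`.
  set K : ℝ := N * (N * √d) + 1
  have hK : 0 < K := by positivity
  have hC : filippovMap (signInteraction G) z ⊆ φ ⁻¹' Set.Ici (0 - ε) := by
    refine filippovMap_subset ((convex_Ici _).linear_preimage (φ : (Fin N → Vec d) →ₗ[ℝ] ℝ))
      (isClosed_Ici.preimage φ.continuous) (div_pos hε hK) fun p hp => ?_
    rw [Set.mem_preimage, Set.mem_Ici, hφ]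
    have h1 := sum_inner_signInteraction_nonneg G p
    have h2 : ∀ i, ⟪p i, signInteraction G p i⟫_ℝ - ε / K * (N * √d) ≤
        ⟪z i, signInteraction G p i⟫_ℝ := fun i => by
      have h3 := real_inner_le_norm (p i - z i) (signInteraction G p i)
      have h4 : ‖p i - z i‖ ≤ ε / K := by
        rw [Metric.mem_ball, dist_eq_norm] at hp
        exact (norm_le_pi_norm (p - z) i).trans hp.le
      have h5 := mul_le_mul h4 (norm_signInteraction_le G p i) (norm_nonneg _) (by positivity)
      rw [inner_sub_left] at h3
      linarith
    have h3 := Finset.sum_le_sum fun i (_ : i ∈ Finset.univ) => h2 i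
    rw [Finset.sum_sub_distrib, Finset.sum_const, Finset.card_univ, Fintype.card_fin,
      nsmul_eq_mul] at h3
    have h4 : (N : ℝ) * (ε / K * (N * √d)) ≤ ε := by
      rw [show (N : ℝ) * (ε / K * (N * √d)) = ε * ((K - 1) / K) by simp only [K]; ring]
      refine mul_le_of_le_one_right hε.le ?_
      rw [div_le_one hK]
      linarith
    linarith
  exact hC hξ

/-- The Laplacian interaction as a linear map. -/
noncomputable def laplacianLinearMap (d : ℕ) : (Fin N → Vec d) →ₗ[ℝ] (Fin N → Vec d) where
  toFun := laplacianInteraction G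
  map_add' x y := by
    ext1 i
    simp only [laplacianInteraction, Pi.add_apply, ← Finset.sum_add_distrib, ← smul_add]
    exact Finset.sum_congr rfl fun j _ => by rw [add_sub_add_comm]
  map_smul' c x := by
    ext1 i
    simp only [laplacianInteraction, Pi.smul_apply, Finset.smul_sum, RingHom.id_apply]
    exact Finset.sum_congr rfl fun j _ => by rw [← smul_sub, smul_comm]

theorem norm_sq_le_sum_norm_sq (u : Fin N → Vec d) : ‖u‖ ^ 2 ≤ ∑ i, ‖u i‖ ^ 2 := by
  have h : ‖u‖ ≤ √(∑ i, ‖u i‖ ^ 2) := by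
    refine (pi_norm_le_iff_of_nonneg (Real.sqrt_nonneg _)).mpr fun i => Real.le_sqrt_of_sq_le ?_
    exact Finset.single_le_sum (f := fun i => ‖u i‖ ^ 2) (fun j _ => sq_nonneg _)
      (Finset.mem_univ i)
  calc ‖u‖ ^ 2 ≤ √(∑ i, ‖u i‖ ^ 2) ^ 2 := by gcongr
    _ = _ := Real.sq_sqrt (Finset.sum_nonneg fun i _ => sq_nonneg _)

/-- The Laplacian is bounded below off its kernel. -/
theorem exists_sum_inner_laplacianInteraction_le (d : ℕ) :
    ∃ C > 0, ∀ x : Fin N → Vec d, ∑ i, ⟪x i, laplacianInteraction G x i⟫_ℝ ≤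
      C * ∑ i, ‖laplacianInteraction G x i‖ ^ 2 := by
  -- Onto its range, the Laplacian has preimages of controlled norm. By symmetry, such a `y` may
  -- replace `x` in the energy.
  let L := (laplacianLinearMap G d).rangeRestrict.toContinuousLinearMap
  obtain ⟨C, hC, h⟩ := L.exists_preimage_norm_le (laplacianLinearMap G d).surjective_rangeRestrict
  refine ⟨N * C + 1, by positivity, fun x => ?_⟩
  obtain ⟨y, hy, hyn⟩ := h (L x)
  have hy' : laplacianInteraction G y = laplacianInteraction G x := congrArg Subtype.val hy
  have hyn' : ‖y‖ ≤ C * ‖laplacianInteraction G x‖ := hyn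
  have h1 : ∑ i, ⟪x i, laplacianInteraction G x i⟫_ℝ = ∑ i, ⟪y i, laplacianInteraction G x i⟫_ℝ := by
    rw [sum_inner_laplacianInteraction_comm G y, hy']
    exact Finset.sum_congr rfl fun i _ => real_inner_comm _ _
  set u := laplacianInteraction G x
  calc ∑ i, ⟪x i, u i⟫_ℝ = ∑ i, ⟪y i, u i⟫_ℝ := h1
    _ ≤ ∑ _i : Fin N, C * ‖u‖ ^ 2 := Finset.sum_le_sum fun i _ => by
        calc ⟪y i, u i⟫_ℝ ≤ ‖y i‖ * ‖u i‖ := real_inner_le_norm _ _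
          _ ≤ (C * ‖u‖) * ‖u‖ := by
            gcongr
            · exact (norm_le_pi_norm y i).trans hyn'
            · exact norm_le_pi_norm u i
          _ = C * ‖u‖ ^ 2 := by ring
    _ = N * C * ‖u‖ ^ 2 := by simp; ring
    _ ≤ (N * C + 1) * ∑ i, ‖u i‖ ^ 2 := by
        gcongr
        · linarith
        · exact norm_sq_le_sum_norm_sq u

theorem sum_inner_laplacianInteraction_nonneg (x : Fin N → Vec d) :
    0 ≤ ∑ i, ⟪x i, laplacianInteraction G x i⟫_ℝ := by
  rw [sum_inner_laplacianInteraction]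
  exact div_nonneg (Finset.sum_nonneg fun i _ => Finset.sum_nonneg fun j _ =>
    mul_nonneg (adjMatrix_nonneg G i j) real_inner_self_nonneg) zero_le_two

theorem norm_sub_sq_le_of_adj (x : Fin N → Vec d) {i j : Fin N} (hij : G.Adj i j) :
    ‖x i - x j‖ ^ 2 ≤ 2 * ∑ i, ⟪x i, laplacianInteraction G x i⟫_ℝ := by
  rw [sum_inner_laplacianInteraction, mul_div_cancel₀ _ two_ne_zero]
  have hnn : ∀ i j, 0 ≤ G.adjMatrix ℝ i j * ⟪x i - x j, x i - x j⟫_ℝ := fun i j =>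
    mul_nonneg (adjMatrix_nonneg G i j) real_inner_self_nonneg
  calc ‖x i - x j‖ ^ 2 = G.adjMatrix ℝ i j * ⟪x i - x j, x i - x j⟫_ℝ := by
        simp [SimpleGraph.adjMatrix_apply, hij]
    _ ≤ ∑ j, G.adjMatrix ℝ i j * ⟪x i - x j, x i - x j⟫_ℝ :=
        Finset.single_le_sum (f := fun j => G.adjMatrix ℝ i j * ⟪x i - x j, x i - x j⟫_ℝ)
          (fun j _ => hnn i j) (Finset.mem_univ j)
    _ ≤ _ := Finset.single_le_sum
          (f := fun i => ∑ j, G.adjMatrix ℝ i j * ⟪x i - x j, x i - x j⟫_ℝ)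
          (fun i _ => Finset.sum_nonneg fun j _ => hnn i j) (Finset.mem_univ i)

/-- On a connected graph, vanishing Laplacian energy means consensus. -/
theorem tendsto_sub_of_tendsto_sum_inner_laplacianInteraction (hG : G.Connected)
    {α : Type*} {l : Filter α} {x : α → Fin N → Vec d}
    (h : Tendsto (fun t => ∑ i, ⟪x t i, laplacianInteraction G (x t) i⟫_ℝ) l (𝓝 0))
    (i j : Fin N) : Tendsto (fun t => x t i - x t j) l (𝓝 0) := by
  -- The energy controls differences across edges; telescope along a walk.
  obtain ⟨w⟩ := hG.preconnected i j
  induction w with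
  | nil => simpa using tendsto_const_nhds
  | @cons i k j hik _ ih =>
    have h1 : Tendsto (fun t => ‖x t i - x t k‖ ^ 2) l (𝓝 0) :=
      squeeze_zero (fun t => sq_nonneg _) (fun t => norm_sub_sq_le_of_adj G (x t) hik)
        (by simpa using h.const_mul 2)
    have h2 : Tendsto (fun t => x t i - x t k) l (𝓝 0) := by
      rw [tendsto_zero_iff_norm_tendsto_zero]
      simpa [Real.sqrt_sq] using h1.sqrt
    simpa using h2.add ih

end Graph

/-! ### Absolutely continuous functions and differential inequalities. -/

section AbsolutelyContinuous

variable {E F : Type*} [NormedAddCommGroup E] [NormedAddCommGroup F] {a b : ℝ}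

theorem LipschitzOnWith.comp_absolutelyContinuousOnInterval {g : E → F} {K : NNReal} {s : Set E}
    (hg : LipschitzOnWith K g s) {u : ℝ → E} (hu : AbsolutelyContinuousOnInterval u a b)
    (hs : Set.MapsTo u (Set.uIcc a b) s) :
    AbsolutelyContinuousOnInterval (fun t => g (u t)) a b := by
  have h0 := Tendsto.const_mul (K : ℝ) hu
  rw [mul_zero] at h0
  refine tendsto_of_tendsto_of_tendsto_of_le_of_le' tendsto_const_nhds h0
    (Eventually.of_forall fun I => Finset.sum_nonneg fun i _ => dist_nonneg) ?_
  refine eventually_inf_principal.mpr (Eventually.of_forall fun I hI => ?_)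
  rw [Finset.mul_sum]
  exact Finset.sum_le_sum fun i hi => hg.dist_le_mul _ (hs (hI.1 i hi).1) _ (hs (hI.1 i hi).2)

/-- The path stays in a compact convex ball, where `g` is Lipschitz. -/
theorem ContDiff.comp_absolutelyContinuousOnInterval [NormedSpace ℝ E] [NormedSpace ℝ F]
    [ProperSpace E] {g : E → F} (hg : ContDiff ℝ 1 g) {u : ℝ → E}
    (hu : AbsolutelyContinuousOnInterval u a b) :
    AbsolutelyContinuousOnInterval (fun t => g (u t)) a b := by
  obtain ⟨C, hC⟩ := hu.exists_bound
  obtain ⟨K, hK⟩ := hg.contDiffOn.exists_lipschitzOnWith one_ne_zero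
    (convex_closedBall (0 : E) C) (isCompact_closedBall 0 C)
  exact hK.comp_absolutelyContinuousOnInterval hu fun t ht => by simpa using hC t ht

theorem AbsolutelyContinuousOnInterval.fun_sum [NormedSpace ℝ E] {ι : Type*} {u : ι → ℝ → E}
    (s : Finset ι) (hu : ∀ i ∈ s, AbsolutelyContinuousOnInterval (u i) a b) :
    AbsolutelyContinuousOnInterval (fun t => ∑ i ∈ s, u i t) a b := by
  classical
  induction s using Finset.induction_on with
  | empty =>
    simpa using (LipschitzWith.const (0 : E)).lipschitzOnWith.absolutelyContinuousOnInterval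
  | insert i s hi ih =>
    simp only [Finset.sum_insert hi]
    exact (hu i (Finset.mem_insert_self i s)).fun_add
      (ih fun j hj => hu j (Finset.mem_insert_of_mem hj))

/-- An absolutely continuous function with nonpositive derivative almost everywhere decreases. -/
theorem AbsolutelyContinuousOnInterval.le_of_ae_hasDerivAt_nonpos {w : ℝ → ℝ} (hab : a ≤ b)
    (hw : AbsolutelyContinuousOnInterval w a b)
    (h : ∀ᵐ t : ℝ, t ∈ Set.Icc a b → ∃ w', w' ≤ 0 ∧ HasDerivAt w w' t) : w b ≤ w a := by
  have h1 : 0 ≤ ∫ t in a..b, -deriv w t := by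
    refine intervalIntegral.integral_nonneg_of_ae_restrict hab ?_
    refine (ae_restrict_iff' measurableSet_Icc).mpr ?_
    filter_upwards [h] with t ht htm
    obtain ⟨w', hw', hd⟩ := ht htm
    simpa [hd.deriv] using hw'
  rw [intervalIntegral.integral_neg, hw.integral_deriv_eq_sub] at h1
  linarith

/-- The differential inequality `ẇ ≤ -κ w` forces exponential decay. -/
theorem le_mul_exp_of_ae_hasDerivAt_le {w : ℝ → ℝ} {κ : ℝ}
    (hw : ∀ T, 0 ≤ T → AbsolutelyContinuousOnInterval w 0 T)
    (h : ∀ᵐ t : ℝ, 0 ≤ t → ∃ w', w' ≤ -κ * w t ∧ HasDerivAt w w' t) {t : ℝ} (ht : 0 ≤ t) :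
    w t ≤ w 0 * Real.exp (-κ * t) := by
  have hexp : AbsolutelyContinuousOnInterval (fun s => Real.exp (κ * s)) 0 t :=
    ContDiffOn.absolutelyContinuousOnInterval (by fun_prop)
  -- The integrating factor `exp (κ s)` makes the product nonincreasing.
  have h1 := (hexp.fun_mul (hw t ht)).le_of_ae_hasDerivAt_nonpos ht (by
    filter_upwards [h] with s hs hst
    obtain ⟨w', hw', hd⟩ := hs hst.1
    refine ⟨_, ?_, (((hasDerivAt_id s).const_mul κ).exp).mul hd⟩
    have := Real.exp_pos (κ * s)
    simp only [id, mul_one]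
    nlinarith)
  simp only [mul_zero, Real.exp_zero, one_mul] at h1
  rw [neg_mul, Real.exp_neg, ← div_eq_mul_inv, le_div_iff₀ (Real.exp_pos _)]
  linarith

theorem tendsto_zero_of_ae_hasDerivAt_le {w : ℝ → ℝ} {κ : ℝ} (hκ : 0 < κ) (hnn : ∀ t, 0 ≤ w t)
    (hw : ∀ T, 0 ≤ T → AbsolutelyContinuousOnInterval w 0 T)
    (h : ∀ᵐ t : ℝ, 0 ≤ t → ∃ w', w' ≤ -κ * w t ∧ HasDerivAt w w' t) :
    Tendsto w atTop (𝓝 0) := by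
  have h1 : Tendsto (fun t => w 0 * Real.exp (-κ * t)) atTop (𝓝 0) := by
    have := (Real.tendsto_exp_atBot.comp
      (tendsto_id.const_mul_atTop_of_neg (neg_neg_of_pos hκ))).const_mul (w 0)
    simpa using this
  exact squeeze_zero' (Eventually.of_forall hnn)
    ((eventually_ge_atTop 0).mono fun t ht => le_mul_exp_of_ae_hasDerivAt_le hw h ht) h1

end AbsolutelyContinuous

/-! ### Lyapunov analysis of the dynamics. -/

section Dynamics

variable {N d : ℕ} {G : SimpleGraph (Fin N)} [DecidableRel G.Adj] {f : Fin N → Vec d → ℝ}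
  {m M : Fin N → ℝ} {x v : ℝ → Fin N → Vec d}

theorem hasDerivAt_sum_inner_laplacianInteraction {x' : Fin N → Vec d} {t : ℝ}
    (hx : ∀ i, HasDerivAt (fun s => x s i) (x' i) t) :
    HasDerivAt (fun s => ∑ i, ⟪x s i, laplacianInteraction G (x s) i⟫_ℝ)
      (2 * ∑ i, ⟪laplacianInteraction G (x t) i, x' i⟫_ℝ) t := by
  have hL : ∀ i, HasDerivAt (fun s => laplacianInteraction G (x s) i)
      (laplacianInteraction G x' i) t := fun i => by
    unfold laplacianInteraction
    exact HasDerivAt.fun_sum fun j _ => ((hx i).fun_sub (hx j)).fun_const_smul _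
  refine (HasDerivAt.fun_sum fun i (_ : i ∈ Finset.univ) => (hx i).inner ℝ (hL i)).congr_deriv ?_
  rw [Finset.sum_add_distrib, sum_inner_laplacianInteraction_comm, two_mul]
  congr 1
  exact Finset.sum_congr rfl fun i _ => real_inner_comm _ _

namespace IsHISOSolution

theorem hasDerivAt_hisoOutput (hf : ∀ i, HasBoundedHessian (f i) (m i) (M i)) {t : ℝ}
    {ξ : Fin N → Vec d}
    (hx : ∀ i, HasDerivAt (fun s => x s i)
      (-(hessian (f i) (x t i)).inverse
        (hisoOutput f (x t) (v t) i + laplacianInteraction G (x t) i)) t)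
    (hv : HasDerivAt v (-ξ + laplacianInteraction G (x t)) t) (i : Fin N) :
    HasDerivAt (fun s => hisoOutput f (x s) (v s) i)
      (-(hisoOutput f (x t) (v t) i + ξ i)) t := by
  refine ((((hf i).hasFDerivAt_gradient (x t i)).comp_hasDerivAt t (hx i)).add
    (hasDerivAt_pi.mp hv i)).congr_deriv ?_
  rw [map_neg, ((hf i).isInvertible_hessian _).self_apply_inverse]
  simp only [Pi.add_apply, Pi.neg_apply]
  abel

/-- Both interactions sum to zero over the nodes, so `∑ vⁱ` is conserved. -/
theorem sum_eq_zero (h : IsHISOSolution G f x v) (h0 : ∑ i, v 0 i = 0) {t : ℝ} (ht : 0 ≤ t) :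
    ∑ i, v t i = 0 := by
  let φ : (Fin N → Vec d) →L[ℝ] Vec d := ∑ i, ContinuousLinearMap.proj i
  have hφ : ∀ η, φ η = ∑ i, η i := fun η => by simp [φ]
  obtain ⟨C, hC⟩ := (φ.contDiff.comp_absolutelyContinuousOnInterval
    (h.absolutelyContinuous_v t ht)).const_of_ae_hasDerivAt_zero (by
      filter_upwards [h.deriv_v] with s hs hst
      rw [Set.uIcc_of_le ht] at hst
      obtain ⟨ξ, hξ, hd⟩ := hs hst.1
      refine (φ.hasFDerivAt.comp_hasDerivAt s hd).congr_deriv ?_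
      rw [map_add, map_neg, hφ, hφ, sum_eq_zero_of_mem_filippovMap G hξ,
        sum_laplacianInteraction, neg_zero, add_zero])
  rw [← hφ, hC t Set.right_mem_uIcc, ← hC 0 Set.left_mem_uIcc, hφ, h0]

theorem absolutelyContinuousOnInterval_hisoOutput (h : IsHISOSolution G f x v)
    (hf : ∀ i, HasBoundedHessian (f i) (m i) (M i)) (i : Fin N) {T : ℝ} (hT : 0 ≤ T) :
    AbsolutelyContinuousOnInterval (fun t => hisoOutput f (x t) (v t) i) 0 T := by
  have hp : LipschitzOnWith 1 (fun u : Fin N → Vec d => u i) Set.univ :=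
    (LipschitzWith.eval i).lipschitzOnWith
  exact ((hf i).lipschitzWith_gradient.lipschitzOnWith.comp_absolutelyContinuousOnInterval
    (hp.comp_absolutelyContinuousOnInterval (h.absolutelyContinuous_x T hT) (Set.mapsTo_univ _ _))
    (Set.mapsTo_univ _ _)).fun_add
    (hp.comp_absolutelyContinuousOnInterval (h.absolutelyContinuous_v T hT) (Set.mapsTo_univ _ _))

/-- The Lyapunov function: Laplacian energy of `x` plus a multiple of `‖z‖²`. -/
theorem exists_tendsto_lyapunov (h : IsHISOSolution G f x v)
    (hf : ∀ i, HasBoundedHessian (f i) (m i) (M i)) :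
    ∃ β > 0, Tendsto (fun t => ∑ i, ⟪x t i, laplacianInteraction G (x t) i⟫_ℝ +
      β * ∑ i, ‖hisoOutput f (x t) (v t) i‖ ^ 2) atTop (𝓝 0) := by
  obtain ⟨C, hC, hLC⟩ := exists_sum_inner_laplacianInteraction_le G d
  have hm := fun i => (hf i).lower_pos
  have hM := fun i => (hf i).upper_pos
  -- `A` and `β` dominate every `M i` and `M i / m i ^ 2`; the sums avoid maxima, and `+ 1` ensures
  -- positivity.
  let A : ℝ := ∑ i, M i + 1
  have hA : 0 < A := add_pos_of_nonneg_of_pos (Finset.sum_nonneg fun i _ => (hM i).le) one_pos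
  have hMA : ∀ i, M i ≤ A := fun i =>
    (Finset.single_le_sum (fun i _ => (hM i).le) (Finset.mem_univ i)).trans
      (le_add_of_nonneg_right one_pos.le)
  have hBnn : ∀ i, 0 ≤ M i / m i ^ 2 := fun i => by have := hM i; positivity
  let β : ℝ := ∑ i, M i / m i ^ 2 + 1
  have hβ : 0 < β := add_pos_of_nonneg_of_pos (Finset.sum_nonneg fun i _ => hBnn i) one_pos
  have hMβ : ∀ i, M i / m i ^ 2 ≤ β := fun i =>
    (Finset.single_le_sum (fun i _ => hBnn i) (Finset.mem_univ i)).trans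
      (le_add_of_nonneg_right one_pos.le)
  have hkey : ∀ (i : Fin N) (p w z : Vec d),
      2 * ⟪w, -(hessian (f i) p).inverse (z + w)⟫_ℝ ≤ -(‖w‖ ^ 2 / A) + β * ‖z‖ ^ 2 := by
    intro i p w z
    have h1 := (hf i).inner_inverse_hessian_add_ge p w z
    have h2 : ‖w‖ ^ 2 / A ≤ ‖w‖ ^ 2 / M i := by
      have := hM i
      gcongr
      exact hMA i
    have h3 : M i / m i ^ 2 * ‖z‖ ^ 2 ≤ β * ‖z‖ ^ 2 := by
      gcongr
      exact hMβ i
    have h4 : ‖w‖ ^ 2 / (2 * M i) = ‖w‖ ^ 2 / M i / 2 := by rw [div_div, mul_comm]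
    have h5 : M i / (2 * m i ^ 2) = M i / m i ^ 2 / 2 := by rw [div_div, mul_comm]
    rw [h4, h5] at h1
    rw [inner_neg_right]
    linarith
  refine ⟨β, hβ, ?_⟩
  -- The rate `1 / (A * C)` comes from the Laplacian energy. The `1` is what remains for `β‖z‖²`:
  -- decay at rate `2`, less the `β‖z‖²` lost to the cross term.
  refine tendsto_zero_of_ae_hasDerivAt_le (κ := min (1 / (A * C)) 1) (by positivity)
    (fun t => add_nonneg (sum_inner_laplacianInteraction_nonneg G _)
      (mul_nonneg hβ.le (Finset.sum_nonneg fun i _ => sq_nonneg _))) (fun T hT => ?_) ?_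
  · refine AbsolutelyContinuousOnInterval.fun_add ?_ (.const_mul β ?_)
    · refine ContDiff.comp_absolutelyContinuousOnInterval
        (g := fun y : Fin N → Vec d => ∑ i, ⟪y i, laplacianInteraction G y i⟫_ℝ) ?_
        (h.absolutelyContinuous_x T hT)
      refine ContDiff.sum fun i _ => (contDiff_apply ℝ (Vec d) i).inner ℝ ?_
      unfold laplacianInteraction
      fun_prop
    · exact .fun_sum _ fun i _ => (contDiff_norm_sq ℝ).comp_absolutelyContinuousOnInterval
        (h.absolutelyContinuousOnInterval_hisoOutput hf i hT)
  · filter_upwards [h.deriv_x, h.deriv_v] with t hx hv ht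
    obtain ⟨ξ, hξ, hvd⟩ := hv ht
    have hz := hasDerivAt_hisoOutput hf (hx ht) hvd
    refine ⟨_, ?_, (hasDerivAt_sum_inner_laplacianInteraction (hx ht)).add
      ((HasDerivAt.fun_sum fun i (_ : i ∈ Finset.univ) => (hz i).norm_sq).const_mul β)⟩
    set u := laplacianInteraction G (x t)
    set z := hisoOutput f (x t) (v t)
    have h1 : 2 * ∑ i, ⟪u i, -(hessian (f i) (x t i)).inverse (z i + u i)⟫_ℝ ≤
        -((∑ i, ‖u i‖ ^ 2) / A) + β * ∑ i, ‖z i‖ ^ 2 := by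
      rw [Finset.mul_sum, Finset.sum_div, Finset.mul_sum, ← Finset.sum_neg_distrib,
        ← Finset.sum_add_distrib]
      exact Finset.sum_le_sum fun i _ => hkey i (x t i) (u i) (z i)
    have h2 : ∑ i, 2 * ⟪z i, -(z i + ξ i)⟫_ℝ = -2 * (∑ i, ‖z i‖ ^ 2 + ∑ i, ⟪z i, ξ i⟫_ℝ) := by
      rw [← Finset.sum_add_distrib, Finset.mul_sum]
      refine Finset.sum_congr rfl fun i _ => ?_
      rw [inner_neg_right, inner_add_right, real_inner_self_eq_norm_sq]
      ring
    have h3 := sum_inner_nonneg_of_mem_filippovMap G hξ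
    have h4 := hLC (x t)
    have h5 : 0 ≤ ∑ i, ⟪x t i, u i⟫_ℝ := sum_inner_laplacianInteraction_nonneg G (x t)
    have h6 : 0 ≤ ∑ i, ‖z i‖ ^ 2 := Finset.sum_nonneg fun i _ => sq_nonneg _
    rw [h2]
    have h7 : 1 / (A * C) * ∑ i, ⟪x t i, u i⟫_ℝ ≤ (∑ i, ‖u i‖ ^ 2) / A := by
      rw [one_div_mul_eq_div, div_le_div_iff₀ (by positivity) hA]
      nlinarith
    have h8 := mul_le_mul_of_nonneg_right (min_le_left (1 / (A * C)) 1) h5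
    have h9 := mul_le_mul_of_nonneg_right (min_le_right (1 / (A * C)) 1) (mul_nonneg hβ.le h6)
    have h10 := mul_nonneg hβ.le h3
    linarith

theorem tendsto_hisoOutput (h : IsHISOSolution G f x v)
    (hf : ∀ i, HasBoundedHessian (f i) (m i) (M i)) (i : Fin N) :
    Tendsto (fun t => hisoOutput f (x t) (v t) i) atTop (𝓝 0) := by
  obtain ⟨β, hβ, hlim⟩ := h.exists_tendsto_lyapunov hf
  rw [tendsto_zero_iff_norm_tendsto_zero]
  have h1 : Tendsto (fun t => ‖hisoOutput f (x t) (v t) i‖ ^ 2) atTop (𝓝 0) := by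
    refine squeeze_zero (fun t => sq_nonneg _) (fun t => ?_) (by simpa using hlim.const_mul β⁻¹)
    have h2 := sum_inner_laplacianInteraction_nonneg G (x t)
    have h3 := Finset.single_le_sum (f := fun i => ‖hisoOutput f (x t) (v t) i‖ ^ 2)
      (fun j _ => sq_nonneg _) (Finset.mem_univ i)
    rw [le_inv_mul_iff₀ hβ]
    have := mul_le_mul_of_nonneg_left h3 hβ.le
    linarith
  simpa [Real.sqrt_sq] using h1.sqrt

theorem tendsto_sub (h : IsHISOSolution G f x v)
    (hf : ∀ i, HasBoundedHessian (f i) (m i) (M i)) (hG : G.Connected) (i j : Fin N) :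
    Tendsto (fun t => x t i - x t j) atTop (𝓝 0) := by
  obtain ⟨β, hβ, hlim⟩ := h.exists_tendsto_lyapunov hf
  refine tendsto_sub_of_tendsto_sum_inner_laplacianInteraction G hG
    (squeeze_zero (fun t => sum_inner_laplacianInteraction_nonneg G (x t)) (fun t => ?_) hlim) i j
  exact le_add_of_nonneg_right
    (mul_nonneg hβ.le (Finset.sum_nonneg fun i _ => sq_nonneg _))

/-- Since `∑ vⁱ = 0`, the gradients at the separate points `x t j` sum to `∑ zʲ → 0`; consensus
controls the remaining error. -/
theorem tendsto_of_sum_gradient_eq_zero [Nonempty (Fin N)] (h : IsHISOSolution G f x v)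
    (hf : ∀ i, HasBoundedHessian (f i) (m i) (M i)) (hG : G.Connected) (h0 : ∑ i, v 0 i = 0)
    {p : Vec d} (hp : ∑ i, ∇ (f i) p = 0) (i : Fin N) :
    Tendsto (fun t => x t i) atTop (𝓝 p) := by
  have hm := sum_lower_bound_pos hf
  rw [tendsto_iff_norm_sub_tendsto_zero]
  have h1 : Tendsto (fun t => (∑ i, m i)⁻¹ *
      (‖∑ j, hisoOutput f (x t) (v t) j‖ + ∑ j, M j * ‖x t j - x t i‖)) atTop (𝓝 0) := by
    have h2 : Tendsto (fun t => ∑ j, hisoOutput f (x t) (v t) j) atTop (𝓝 0) := by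
      simpa using tendsto_finsetSum Finset.univ fun j _ => h.tendsto_hisoOutput hf j
    have h3 : Tendsto (fun t => ∑ j, M j * ‖x t j - x t i‖) atTop (𝓝 0) := by
      simpa using tendsto_finsetSum Finset.univ fun j _ =>
        (h.tendsto_sub hf hG j i).norm.const_mul (M j)
    simpa using (h2.norm.add h3).const_mul (∑ i, m i)⁻¹
  refine squeeze_zero' (Eventually.of_forall fun t => norm_nonneg _)
    ((eventually_ge_atTop 0).mono fun t ht => ?_) h1
  have h2 : ∑ j, hisoOutput f (x t) (v t) j = ∑ j, ∇ (f j) (x t j) := by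
    simp only [hisoOutput, Finset.sum_add_distrib, h.sum_eq_zero h0 ht, add_zero]
  rw [le_inv_mul_iff₀ hm, h2]
  exact norm_sub_le_of_sum_gradient_eq_zero hf hp (x t i) (x t)

end IsHISOSolution

end Dynamics

theorem theorem2 {N d : ℕ} (G : SimpleGraph (Fin N)) [DecidableRel G.Adj] (hG : G.Connected)
    (f : Fin N → Vec d → ℝ) (m M : Fin N → ℝ) (hf : ∀ i, HasBoundedHessian (f i) (m i) (M i)) :
    ∃ xstar : Vec d,
      (∀ y : Vec d, y ≠ xstar → ∑ i, f i xstar < ∑ i, f i y) ∧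
      ∀ x v : ℝ → Fin N → Vec d, IsHISOSolution G f x v → ∑ i, v 0 i = 0 →
        ∀ i, Tendsto (fun t => x t i) atTop (𝓝 xstar) ∧
          Tendsto (fun t => hisoOutput f (x t) (v t) i) atTop (𝓝 0) := by
  have := hG.nonempty
  obtain ⟨p, hp⟩ := exists_sum_gradient_eq_zero hf
  exact ⟨p, fun y hy => sum_lt_sum_of_sum_gradient_eq_zero hf hp hy, fun x v h h0 i =>
    ⟨h.tendsto_of_sum_gradient_eq_zero hf hG h0 hp i, h.tendsto_hisoOutput hf i⟩⟩
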